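/- Let $n\ge 6$ and let $W$ be the Coxeter group of type $E_n$: its Coxeter generators are $s_0,s_1,\dots,s_{n-1}$, with $m_{ij}=3$ if $\{i,j\}$ is an edge of the graph consisting of the path $1-2-3-\cdots-(n-1)$ and one further vertex $0$ joined only to $3$, and $m_{ij}=2$ for all other $i\ne j$. (For $n\ge 9$ the group $W$ is infinite.) Let $V$ be the real vector space with basis the simple roots $\gamma_0,\dots,\gamma_{n-1}$ and with the Coxeter form $B(\gamma_i,\gamma_j)=-\cos(\pi/m_{ij})$, where $m_{ii}=1$. Let $W$ act on $V$ by $s_i v=v-2B(v,\gamma_i)\gamma_i$, and let $\Phi=\{w\gamma_i\}$ be the root system. For $w\in W$ let $\Phi(w)$ be the set of positive roots that $w$ sends to negative roots. A reduced expression $s_{i_1}\cdots s_{i_k}$ for $w$ has the root sequence $(r_1,\dots,r_k)$, where $r_1=\gamma_{i_k}$ and $r_q=s_{i_k}\cdots s_{i_{k-q+2}}(\gamma_{i_{k-q+1}})$ for $2\le q\le k$. A contractible triple of $w$ is a subset of $\Phi(w)$ of the form $\{\alpha,\beta,\alpha+\beta\}$ whose elements appear consecutively, in some order, in the root sequence of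 some reduced expression for $w$. The element $w$ is called maximally clustered if, for any two contractible triples $T,T'$ of $w$ with $T\cap T'\neq\emptyset$, the highest roots (the roots of greatest height, where the height of a root is the sum of its coefficients in the basis of simple roots) of $T$ and $T'$ agree. Then $W$ has only finitely many maximally clustered elements. -/

import Mathlib

/-- The edges of the Coxeter graph of type `E_n`, listed with the smaller vertex first. The vertices
are `0, 1, …, n - 1`; the vertices `1 - 2 - 3 - ⋯ - (n - 1)` form a path, and `0` is joined to `3`
only. -/
def CoxeterMatrix.typeEEdge (i j : ℕ) : Prop :=
  (1 ≤ i ∧ i + 1 = j) ∨ (i = 0 ∧ j = 3)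

instance CoxeterMatrix.typeEEdge.decidable (i j : ℕ) :
    Decidable (CoxeterMatrix.typeEEdge i j) := by
  unfold CoxeterMatrix.typeEEdge
  infer_instance

/-- The Coxeter matrix of type `E_n` (`n` generators; meant for `n ≥ 6`). -/
def CoxeterMatrix.typeE (n : ℕ) : CoxeterMatrix (Fin n) where
  M := Matrix.of fun i j =>
    if i = j then 1
    else if CoxeterMatrix.typeEEdge i j ∨ CoxeterMatrix.typeEEdge j i then 3
    else 2
  isSymm := by
    ext i j
    simp only [Matrix.transpose_apply, Matrix.of_apply, eq_comm (a := i) (b := j),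
      or_comm (a := CoxeterMatrix.typeEEdge i j)]
  diagonal := by intro i; simp
  off_diagonal := by
    intro i j h
    simp only [Matrix.of_apply, if_neg h]
    split_ifs <;> norm_num

/-- A Coxeter matrix is simply laced if `m_{ij} ∈ {2, 3}` for all `i ≠ j`. -/
class CoxeterMatrix.IsSimplyLaced {B : Type*} (M : CoxeterMatrix B) : Prop where
  eq_two_or_eq_three : ∀ i j : B, i ≠ j → M i j = 2 ∨ M i j = 3

instance CoxeterMatrix.typeE_isSimplyLaced (n : ℕ) : (CoxeterMatrix.typeE n).IsSimplyLaced where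
  eq_two_or_eq_three := by
    intro i j h
    change (if i = j then 1 else
      if CoxeterMatrix.typeEEdge i j ∨ CoxeterMatrix.typeEEdge j i then 3 else 2) = 2 ∨
      (if i = j then 1 else
      if CoxeterMatrix.typeEEdge i j ∨ CoxeterMatrix.typeEEdge j i then 3 else 2) = 3
    rw [if_neg h]
    split_ifs <;> simp

namespace CoxeterMatrix

variable {B : Type*} [Fintype B] [DecidableEq B]

/-- The simple root `γ_i`, the `i`-th standard basis vector of `V = ℝ^B`. -/
noncomputable def simpleRoot (i : B) : B → ℝ := Pi.single i 1

/-- The Coxeter form: the bilinear form on `V` with `B(γ_i, γ_j) = - cos (π / m_{ij})`. -/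
noncomputable def coxeterForm (M : CoxeterMatrix B) : LinearMap.BilinForm ℝ (B → ℝ) :=
  Matrix.toBilin' (Matrix.of fun i j => - Real.cos (Real.pi / (M i j : ℝ)))

/-- The reflection `v ↦ v - 2 B(v, γ_i) γ_i` of `V`. -/
noncomputable def simpleReflection (M : CoxeterMatrix B) (i : B) : Module.End ℝ (B → ℝ) :=
  LinearMap.id - (2 : ℝ) • (M.coxeterForm.flip (simpleRoot i)).smulRight (simpleRoot i)

theorem simpleReflection_apply (M : CoxeterMatrix B) (i : B) (v : B → ℝ) :
    M.simpleReflection i v = v - (2 * M.coxeterForm v (simpleRoot i)) • simpleRoot i := by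
  simp [simpleReflection, mul_smul]

theorem coxeterForm_simpleRoot (M : CoxeterMatrix B) (i j : B) :
    M.coxeterForm (simpleRoot i) (simpleRoot j) = - Real.cos (Real.pi / (M i j : ℝ)) := by
  simp [coxeterForm, simpleRoot]

/-- The simple reflections satisfy the Coxeter relations of a simply laced Coxeter group. -/
theorem isLiftable_simpleReflection (M : CoxeterMatrix B) [hM : M.IsSimplyLaced] :
    M.IsLiftable M.simpleReflection := by
  intro i j
  have hii : ∀ k, M.coxeterForm (simpleRoot k) (simpleRoot k) = 1 := by
    intro k; rw [coxeterForm_simpleRoot]; simp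
  by_cases hij : i = j
  · subst hij
    rw [M.diagonal, pow_one]
    refine LinearMap.ext fun v => ?_
    simp only [Module.End.mul_apply, simpleReflection_apply, Module.End.one_apply, map_sub,
      map_smul, hii]
    module
  · have hji : M.coxeterForm (simpleRoot j) (simpleRoot i) =
        M.coxeterForm (simpleRoot i) (simpleRoot j) := by
      rw [coxeterForm_simpleRoot, coxeterForm_simpleRoot, M.symmetric]
    rcases hM.eq_two_or_eq_three i j hij with h | h
    · have h0 : M.coxeterForm (simpleRoot i) (simpleRoot j) = 0 := by
        rw [coxeterForm_simpleRoot, h]; simp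
      rw [h0] at hji
      rw [h, pow_two]
      refine LinearMap.ext fun v => ?_
      simp only [Module.End.mul_apply, simpleReflection_apply, Module.End.one_apply, map_sub,
        map_smul, hii, h0, hji]
      module
    · have h0 : M.coxeterForm (simpleRoot i) (simpleRoot j) = -(1 / 2) := by
        rw [coxeterForm_simpleRoot, h]; simp
      rw [h0] at hji
      rw [h, pow_succ, pow_two]
      refine LinearMap.ext fun v => ?_
      simp only [Module.End.mul_apply, simpleReflection_apply, Module.End.one_apply, map_sub,
        map_smul, hii, h0, hji]
      module

end CoxeterMatrix

namespace CoxeterSystem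

variable {B : Type*} [Fintype B] [DecidableEq B] {M : CoxeterMatrix B} [M.IsSimplyLaced]
  {W : Type*} [Group W] (cs : CoxeterSystem M W)

/-- The reflection representation of `W` on `V`, with `s_i v = v - 2 B(v, γ_i) γ_i`. -/
noncomputable def reflectionRep : Representation ℝ W (B → ℝ) :=
  cs.lift ⟨M.simpleReflection, M.isLiftable_simpleReflection⟩

/-- The root system `Φ = {w γ_i}`. -/
def roots : Set (B → ℝ) :=
  {α | ∃ (w : W) (i : B), α = cs.reflectionRep w (CoxeterMatrix.simpleRoot i)}

/-- The positive roots: all coefficients are nonnegative. -/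
def posRoots : Set (B → ℝ) := {α | α ∈ cs.roots ∧ ∀ i, 0 ≤ α i}

/-- The negative roots: all coefficients are nonpositive. -/
def negRoots : Set (B → ℝ) := {α | α ∈ cs.roots ∧ ∀ i, α i ≤ 0}

/-- `Φ(w)`, the set of positive roots sent to negative roots by `w`. -/
def inversionRoots (w : W) : Set (B → ℝ) :=
  {α | α ∈ cs.posRoots ∧ cs.reflectionRep w α ∈ cs.negRoots}

/-- The root sequence of a word `i_1 ⋯ i_n`, namely `(r_1, …, r_n)` with `r_1 = γ_{i_n}` and
`r_q = s_{i_n} ⋯ s_{i_{n-q+2}} γ_{i_{n-q+1}}`. In particular the last entry is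
`r_n = (s_{i_2} ⋯ s_{i_n})⁻¹ γ_{i_1}` and the others form the root sequence of `i_2 ⋯ i_n`. -/
noncomputable def rootSeq : List B → List (B → ℝ)
  | [] => []
  | i :: ω => rootSeq ω ++ [cs.reflectionRep (cs.wordProd ω)⁻¹ (CoxeterMatrix.simpleRoot i)]

/-- `r` is a root sequence for `w`: the root sequence of some reduced expression for `w`. -/
def IsRootSeqFor (w : W) (r : List (B → ℝ)) : Prop :=
  ∃ ω : List B, cs.IsReduced ω ∧ cs.wordProd ω = w ∧ cs.rootSeq ω = r

/-- An inversion triple of `w`: a subset of `Φ(w)` of the form `{α, β, α + β}`. -/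
def IsInversionTriple (w : W) (T : Set (B → ℝ)) : Prop :=
  T ⊆ cs.inversionRoots w ∧ ∃ α β : B → ℝ, T = {α, β, α + β}

/-- A contractible triple of `w`: an inversion triple whose elements appear consecutively, in some
order, in some root sequence for `w`. -/
def IsContractibleTriple (w : W) (T : Set (B → ℝ)) : Prop :=
  cs.IsInversionTriple w T ∧
    ∃ r : List (B → ℝ), cs.IsRootSeqFor w r ∧
      ∃ a b c : B → ℝ, [a, b, c] <:+: r ∧ T = {a, b, c}

/-- The height of a root: the sum of its coefficients in the basis of simple roots. -/
def rootHeight {B : Type*} [Fintype B] (α : B → ℝ) : ℝ := ∑ i, α i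

/-- `γ` is the highest root in `T`: the element of `T` of greatest height. -/
def IsHighestRoot {B : Type*} [Fintype B] (T : Set (B → ℝ)) (γ : B → ℝ) : Prop :=
  γ ∈ T ∧ ∀ δ ∈ T, rootHeight δ ≤ rootHeight γ

/-- `w` is maximally clustered: any two intersecting contractible triples of `w` have the same
highest root. -/
def IsMaximallyClustered (w : W) : Prop :=
  ∀ T T' : Set (B → ℝ), cs.IsContractibleTriple w T → cs.IsContractibleTriple w T' →
    (T ∩ T').Nonempty →
      ∀ γ γ' : B → ℝ, IsHighestRoot T γ → IsHighestRoot T' γ' → γ = γ'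

end CoxeterSystem

/-!
A factor `iji` of a reduced word, possibly interspersed with letters commuting with `i`, gives a
contractible triple whose highest root is the one contributed by `j`. In a reduced word of a
maximally clustered element `w`, two such braids can therefore never share an outer letter.

Among the reduced words of `w` take one, `ν`, with the smallest sum of letters. If `iki` with
`k < i` occurred in `ν` as a braid, then `kik` would give a smaller sum; so two occurrences of
`i ≥ 1` with no `i + 1` between them enclose at least two neighbours of `i`. Consequently a factor
of `ν` with letters at most `t` contains `t` at most three times: from four occurrences of `t ≥ 3`
one descends through `t - 1, t - 2, …` to four occurrences of `3`, which the branching of the graph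
at `3` excludes. Hence a factor of `ν` with letters less than `m` has length less than `4 ^ m`.
-/

namespace MaximallyClustered

section Words

open List

section Splitting

variable {α : Type*} [DecidableEq α] {i : α} {y : List α}

theorem exists_first_occurrence (h : 0 < y.count i) :
    ∃ p q, y = p ++ i :: q ∧ p.count i = 0 ∧ q.count i + 1 = y.count i := by
  obtain ⟨p, q, rfl, hp⟩ := eq_append_cons_of_mem (count_pos_iff.1 h)
  have hp : p.count i = 0 := count_eq_zero.2 hp
  exact ⟨p, q, rfl, hp, by simp [hp]⟩

theorem exists_last_occurrence (h : 0 < y.count i) :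
    ∃ p q, y = p ++ i :: q ∧ q.count i = 0 ∧ p.count i + 1 = y.count i := by
  obtain ⟨p, q, hpq, hp, hq⟩ := exists_first_occurrence (y := y.reverse) (by simpa using h)
  exact ⟨q.reverse, p.reverse, by simpa using congrArg reverse hpq, by simpa using hp,
    by simpa using hq⟩

theorem length_lt_of_count_le {K r : ℕ} (hK : ∀ x, x <:+: y → x.count i = 0 → x.length < K)
    (hr : y.count i ≤ r) : y.length < (r + 1) * K := by
  induction r generalizing y with
  | zero => simpa using hK y (infix_refl y) (by omega)
  | succ r ih =>
    obtain h0 | h0 := Nat.eq_zero_or_pos (y.count i)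
    · exact (hK y (infix_refl y) h0).trans_le (Nat.le_mul_of_pos_left K (by omega))
    · obtain ⟨p, q, rfl, hp, hq⟩ := exists_first_occurrence h0
      have hpK : p.length < K := hK p ⟨[], i :: q, by simp⟩ hp
      have hqK : q.length < (r + 1) * K :=
        ih (fun x hx => hK x (hx.trans ⟨p ++ [i], [], by simp⟩)) (by omega)
      rw [length_append, length_cons, Nat.succ_mul]
      omega

end Splitting

section AdjCount

variable {α β : Type*} {G : SimpleGraph α} [DecidableRel G.Adj] {H : SimpleGraph β}
  [DecidableRel H.Adj]

variable (G) in
/-- The number of letters of the word `y`, counted with multiplicity, that are adjacent to `i`. -/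
def adjCount (i : α) (y : List α) : ℕ :=
  y.countP fun k => G.Adj i k

theorem adjCount_append (i : α) (x y : List α) :
    adjCount G i (x ++ y) = adjCount G i x + adjCount G i y :=
  countP_append

theorem adjCount_cons (i k : α) (y : List α) :
    adjCount G i (k :: y) = adjCount G i y + if G.Adj i k then 1 else 0 := by
  simp [adjCount, countP_cons]

theorem adjCount_cons_of_adj {i k : α} (h : G.Adj i k) (y : List α) :
    adjCount G i (k :: y) = adjCount G i y + 1 := by
  rw [adjCount_cons, if_pos h]

theorem adjCount_map (f : G ↪g H) (i : α) (y : List α) :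
    adjCount H (f i) (y.map f) = adjCount G i y := by
  simp only [adjCount, countP_map]
  congr 1
  ext k
  simp

theorem adjCount_eq_sum [DecidableEq α] {i : α} {s : Finset α} (hs : ∀ k, G.Adj i k ↔ k ∈ s)
    (y : List α) : adjCount G i y = ∑ k ∈ s, y.count k := by
  induction y with
  | nil => simp [adjCount]
  | cons k y ih => simp [adjCount_cons, count_cons, Finset.sum_add_distrib, ih, hs]

theorem adjCount_eq_zero_iff {i : α} {y : List α} :
    adjCount G i y = 0 ↔ ∀ k ∈ y, ¬ G.Adj i k := by
  simp [adjCount]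

theorem exists_of_adjCount_eq_one {i : α} {y : List α} (h : adjCount G i y = 1) :
    ∃ y₁ k y₂, y = y₁ ++ k :: y₂ ∧ G.Adj i k ∧ adjCount G i y₁ = 0 ∧ adjCount G i y₂ = 0 := by
  induction y with
  | nil => simp [adjCount] at h
  | cons a y ih =>
    by_cases ha : G.Adj i a
    · exact ⟨[], a, y, rfl, ha, rfl, by simpa [adjCount_cons, ha] using h⟩
    · obtain ⟨y₁, k, y₂, rfl, hk, h₁, h₂⟩ := ih (by simpa [adjCount_cons, ha] using h)
      exact ⟨a :: y₁, k, y₂, rfl, hk, by simpa [adjCount_cons, ha] using h₁, h₂⟩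

variable (G) in
/-- A set of words behaving like the set of reduced words of an element of the simply laced Coxeter
group with graph `G`, none of which contains two braids sharing a letter `j`. Here an occurrence of
a braid `iji` may be interspersed with letters that commute with `i`. -/
structure AvoidsAdjacentBraids (S : Set (List α)) : Prop where
  adjCount_ne_zero {i : α} {a y b : List α} : a ++ i :: (y ++ i :: b) ∈ S → adjCount G i y ≠ 0
  braid_mem {i j : α} {a y₁ y₂ b : List α} : a ++ i :: (y₁ ++ j :: (y₂ ++ i :: b)) ∈ S →
    G.Adj i j → adjCount G i y₁ = 0 → adjCount G i y₂ = 0 →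
    a ++ (y₁ ++ j :: i :: j :: (y₂ ++ b)) ∈ S
  adjCount_ne_one {j : α} {a y y' b : List α} : a ++ j :: (y ++ j :: (y' ++ j :: b)) ∈ S →
    adjCount G j y = 1 → adjCount G j y' ≠ 1

namespace AvoidsAdjacentBraids

theorem image_map (f : G ↪g H) {S : Set (List α)} (hS : AvoidsAdjacentBraids G S) :
    AvoidsAdjacentBraids H (List.map f '' S) where
  adjCount_ne_zero := by
    rintro i a y b ⟨ω, hω, he⟩
    simp only [map_eq_append_iff, map_eq_cons_iff] at he
    obtain ⟨a, _, rfl, rfl, i, _, rfl, rfl, y, _, rfl, rfl, i', b, rfl, hi, rfl⟩ := he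
    obtain rfl := f.injective hi
    rw [adjCount_map]
    exact hS.adjCount_ne_zero hω
  braid_mem := by
    rintro i j a y₁ y₂ b ⟨ω, hω, he⟩ hij h₁ h₂
    simp only [map_eq_append_iff, map_eq_cons_iff] at he
    obtain ⟨a, _, rfl, rfl, i, _, rfl, rfl, y₁, _, rfl, rfl, j, _, rfl, rfl, y₂, _, rfl, rfl,
      i', b, rfl, hi, rfl⟩ := he
    obtain rfl := f.injective hi
    rw [adjCount_map] at h₁ h₂
    exact ⟨_, hS.braid_mem hω (f.map_adj_iff.1 hij) h₁ h₂, by simp⟩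
  adjCount_ne_one := by
    rintro j a y y' b ⟨ω, hω, he⟩
    simp only [map_eq_append_iff, map_eq_cons_iff] at he
    obtain ⟨a, _, rfl, rfl, j, _, rfl, rfl, y, _, rfl, rfl, j', _, rfl, hj, y', _, rfl, rfl,
      j'', b, rfl, hj', rfl⟩ := he
    obtain rfl := f.injective hj
    obtain rfl := f.injective hj'
    rw [adjCount_map, adjCount_map]
    exact hS.adjCount_ne_one hω

variable {S : Set (List α)} {ν : List α} {i j : α}

theorem count_le_one_of_adjCount_eq_zero [DecidableEq α] (hS : AvoidsAdjacentBraids G S)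
    (hν : ν ∈ S) {x : List α} (hx : x <:+: ν) (h0 : adjCount G i x = 0) : x.count i ≤ 1 := by
  by_contra! hc
  obtain ⟨p, x, rfl, -, hpx⟩ := exists_first_occurrence (i := i) (y := x) (by omega)
  obtain ⟨y, q, rfl, -, -⟩ := exists_first_occurrence (i := i) (y := x) (by omega)
  obtain ⟨a, b, rfl⟩ := hx
  refine hS.adjCount_ne_zero (i := i) (a := a ++ p) (y := y) (b := q ++ b) (by simpa using hν) ?_
  simp only [adjCount_append, adjCount_cons] at h0
  omega

/-- If `2 ≤ adjCount G i (x ++ j :: z₁)` failed, then the first two letters `i` would form a braid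
with the `j` between them. Applying it turns the gap `z₁ ++ i :: z₂` into `z₁ ++ z₂` and creates the
gap `[i]` before it, so that `j` would be the middle of two adjacent braids. -/
theorem two_le_adjCount_left (hS : AvoidsAdjacentBraids G S) (hν : ν ∈ S) {x z₁ z₂ : List α}
    (hx : i :: (x ++ j :: (z₁ ++ i :: (z₂ ++ [j]))) <:+: ν) (hij : G.Adj i j)
    (hz : adjCount G j (z₁ ++ i :: z₂) = 2) : 2 ≤ adjCount G i (x ++ j :: z₁) := by
  obtain ⟨a, b, rfl⟩ := hx
  by_contra! hlt
  rw [adjCount_append, adjCount_cons_of_adj hij] at hlt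
  rw [adjCount_append, adjCount_cons_of_adj hij.symm] at hz
  have hbraid : a ++ (x ++ j :: i :: j :: (z₁ ++ (z₂ ++ j :: b))) ∈ S :=
    hS.braid_mem (by simpa using hν) hij (by omega) (by omega)
  refine hS.adjCount_ne_one (j := j) (a := a ++ x) (y := [i]) (y' := z₁ ++ z₂) (b := b)
    (by simpa using hbraid) ?_ ?_
  · rw [adjCount_cons_of_adj hij.symm]; rfl
  · rw [adjCount_append]; omega

theorem two_le_adjCount_right (hS : AvoidsAdjacentBraids G S) (hν : ν ∈ S) {x z₁ z₂ : List α}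
    (hx : j :: (z₁ ++ i :: (z₂ ++ j :: (x ++ [i]))) <:+: ν) (hij : G.Adj i j)
    (hz : adjCount G j (z₁ ++ i :: z₂) = 2) : 2 ≤ adjCount G i (z₂ ++ j :: x) := by
  obtain ⟨a, b, rfl⟩ := hx
  by_contra! hlt
  rw [adjCount_append, adjCount_cons_of_adj hij] at hlt
  rw [adjCount_append, adjCount_cons_of_adj hij.symm] at hz
  have hbraid : a ++ j :: z₁ ++ (z₂ ++ j :: i :: j :: (x ++ b)) ∈ S :=
    hS.braid_mem (by simpa using hν) hij (by omega) (by omega)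
  refine hS.adjCount_ne_one (j := j) (a := a) (y := z₁ ++ z₂) (y' := [i]) (b := x ++ b)
    (by simpa using hbraid) ?_ ?_
  · rw [adjCount_append]; omega
  · rw [adjCount_cons_of_adj hij.symm]; rfl

theorem two_le_adjCount_left_or_right (hS : AvoidsAdjacentBraids G S) (hν : ν ∈ S)
    {x z₁ y z₂ x' : List α}
    (hx : i :: (x ++ j :: (z₁ ++ i :: (y ++ i :: (z₂ ++ j :: (x' ++ [i]))))) <:+: ν)
    (hij : G.Adj i j) (hz : adjCount G j (z₁ ++ i :: (y ++ i :: z₂)) = 3) :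
    2 ≤ adjCount G i (x ++ j :: z₁) ∨ 2 ≤ adjCount G i (z₂ ++ j :: x') := by
  obtain ⟨a, b, rfl⟩ := hx
  rw [or_iff_not_imp_right, not_le]
  intro hlt
  rw [adjCount_append, adjCount_cons_of_adj hij] at hlt
  have hbraid : a ++ i :: (x ++ j :: (z₁ ++ i :: y)) ++ (z₂ ++ j :: i :: j :: (x' ++ b)) ∈ S :=
    hS.braid_mem (by simpa using hν) hij (by omega) (by omega)
  refine hS.two_le_adjCount_left hbraid (z₂ := y ++ z₂) ⟨a, i :: j :: (x' ++ b), by simp⟩ hij ?_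
  simp only [adjCount_append, adjCount_cons_of_adj hij.symm] at hz ⊢
  omega

end AvoidsAdjacentBraids

end AdjCount

end Words

section TypeE

open List

/-- The infinite graph `E_∞`: the path `1 - 2 - 3 - ⋯` together with a vertex `0` joined to `3`. It
contains the Coxeter graphs of all the types `E_n`. -/
def typeEGraph : SimpleGraph ℕ where
  Adj i j := CoxeterMatrix.typeEEdge i j ∨ CoxeterMatrix.typeEEdge j i
  symm := ⟨fun _ _ => Or.symm⟩
  loopless := ⟨fun _ h => by simp only [CoxeterMatrix.typeEEdge] at h; omega⟩

instance typeEGraph.decidableAdj : DecidableRel typeEGraph.Adj :=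
  fun i j => inferInstanceAs <|
    Decidable (CoxeterMatrix.typeEEdge i j ∨ CoxeterMatrix.typeEEdge j i)

theorem typeEGraph_adj {i j : ℕ} :
    typeEGraph.Adj i j ↔ CoxeterMatrix.typeEEdge i j ∨ CoxeterMatrix.typeEEdge j i :=
  Iff.rfl

theorem typeEGraph_adj_succ {i : ℕ} (hi : 1 ≤ i) : typeEGraph.Adj i (i + 1) :=
  Or.inl (Or.inl ⟨hi, rfl⟩)

theorem typeEGraph_adj_zero_three : typeEGraph.Adj 0 3 :=
  Or.inl (Or.inr ⟨rfl, rfl⟩)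

section AdjCountFormulas

variable (y : List ℕ)

theorem adjCount_typeEGraph_zero : adjCount typeEGraph 0 y = y.count 3 := by
  rw [adjCount_eq_sum (s := {3})]
  · simp
  · simp [typeEGraph_adj, CoxeterMatrix.typeEEdge]

theorem adjCount_typeEGraph_one : adjCount typeEGraph 1 y = y.count 2 := by
  rw [adjCount_eq_sum (s := {2})]
  · simp
  · intro k
    simp only [typeEGraph_adj, CoxeterMatrix.typeEEdge, Finset.mem_singleton]
    lia

theorem adjCount_typeEGraph_two : adjCount typeEGraph 2 y = y.count 1 + y.count 3 := by
  rw [adjCount_eq_sum (s := {1, 3})]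
  · simp
  · intro k
    simp only [typeEGraph_adj, CoxeterMatrix.typeEEdge, Finset.mem_insert, Finset.mem_singleton]
    lia

theorem adjCount_typeEGraph_three :
    adjCount typeEGraph 3 y = y.count 0 + y.count 2 + y.count 4 := by
  rw [adjCount_eq_sum (s := {0, 2, 4})]
  · simp [add_assoc]
  · intro k
    simp only [typeEGraph_adj, CoxeterMatrix.typeEEdge, Finset.mem_insert, Finset.mem_singleton]
    lia

theorem adjCount_typeEGraph_succ {i : ℕ} (hi : 3 ≤ i) :
    adjCount typeEGraph (i + 1) y = y.count i + y.count (i + 1 + 1) := by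
  rw [adjCount_eq_sum (s := {i, i + 1 + 1})]
  · rw [Finset.sum_pair (by omega)]
  · intro k
    simp only [typeEGraph_adj, CoxeterMatrix.typeEEdge, Finset.mem_insert, Finset.mem_singleton]
    lia

end AdjCountFormulas

/-- The word `ν` contains four consecutive occurrences of `j` such that the middle gap contains no
`j + 1` and each outer gap contains a neighbour of `j` other than `j + 1`. -/
def HasInteriorGap (ν : List ℕ) (j : ℕ) : Prop :=
  ∃ g₁ z g₂, j :: (g₁ ++ j :: (z ++ j :: (g₂ ++ [j]))) <:+: ν ∧
    g₁.count j = 0 ∧ z.count j = 0 ∧ g₂.count j = 0 ∧ z.count (j + 1) = 0 ∧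
    g₁.count (j + 1) < adjCount typeEGraph j g₁ ∧ g₂.count (j + 1) < adjCount typeEGraph j g₂

variable {S : Set (List ℕ)} {ν : List ℕ}

/-- Otherwise `y` contains a single neighbour `k` of `i`, with `k < i`, and applying the braid `iki`
yields a word with a smaller sum of letters. -/
theorem two_le_adjCount (hS : AvoidsAdjacentBraids typeEGraph S)
    (hν : MinimalFor (· ∈ S) List.sum ν) {i : ℕ} (hi : 1 ≤ i) {y : List ℕ}
    (hx : i :: (y ++ [i]) <:+: ν) (hy : y.count (i + 1) = 0) :
    2 ≤ adjCount typeEGraph i y := by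
  obtain ⟨a, b, rfl⟩ := hx
  have hmem : a ++ i :: (y ++ i :: b) ∈ S := by simpa using hν.prop
  have hne := hS.adjCount_ne_zero hmem
  by_contra! hlt
  obtain ⟨y₁, k, y₂, rfl, hk, h₁, h₂⟩ :=
    exists_of_adjCount_eq_one (G := typeEGraph) (i := i) (y := y) (by omega)
  have hki : k < i := by
    have hk' : k ≠ i + 1 := by rintro rfl; simp at hy
    simp only [typeEGraph_adj, CoxeterMatrix.typeEEdge] at hk
    omega
  have hbraid := hS.braid_mem (by simpa using hmem) hk h₁ h₂
  refine hν.not_lt hbraid ?_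
  simp only [sum_append, sum_cons, sum_nil]
  omega

theorem count_two_le_one (hS : AvoidsAdjacentBraids typeEGraph S)
    (hν : MinimalFor (· ∈ S) List.sum ν) {x : List ℕ} (hx : x <:+: ν) (h3 : x.count 3 = 0) :
    x.count 2 ≤ 1 := by
  by_contra! hc
  obtain ⟨p, x, rfl, -, hpx⟩ := exists_first_occurrence (i := 2) (y := x) (by omega)
  obtain ⟨y, q, rfl, hy, -⟩ := exists_first_occurrence (i := 2) (y := x) (by omega)
  have hx' : 2 :: (y ++ [2]) <:+: ν := .trans ⟨p, q, by simp⟩ hx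
  have h3y : y.count 3 = 0 := by simp only [count_append, count_cons, beq_iff_eq] at h3; lia
  have h2 := two_le_adjCount hS hν (by omega) hx' h3y
  have h1 : y.count 1 ≤ 1 := hS.count_le_one_of_adjCount_eq_zero hν.prop
    (.trans ⟨[2], [2], by simp⟩ hx') (by rwa [adjCount_typeEGraph_one])
  rw [adjCount_typeEGraph_two] at h2
  omega

theorem hasInteriorGap_of_four_le_count (hS : AvoidsAdjacentBraids typeEGraph S)
    (hν : MinimalFor (· ∈ S) List.sum ν) {i : ℕ} (hi : 1 ≤ i) {x : List ℕ} (hx : x <:+: ν)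
    (hsucc : x.count (i + 1) = 0) (h4 : 4 ≤ x.count i) : HasInteriorGap ν i := by
  obtain ⟨p, x, rfl, -, h₁⟩ := exists_first_occurrence (i := i) (y := x) (by omega)
  obtain ⟨g₁, x, rfl, hg₁, h₂⟩ := exists_first_occurrence (i := i) (y := x) (by omega)
  obtain ⟨z, x, rfl, hz, h₃⟩ := exists_first_occurrence (i := i) (y := x) (by omega)
  obtain ⟨g₂, q, rfl, hg₂, -⟩ := exists_first_occurrence (i := i) (y := x) (by omega)
  simp only [count_append, count_cons, beq_iff_eq] at hsucc
  have hx' : i :: (g₁ ++ i :: (z ++ i :: (g₂ ++ [i]))) <:+: ν := .trans ⟨p, q, by simp⟩ hx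
  have hl₁ : 2 ≤ adjCount typeEGraph i g₁ := two_le_adjCount hS hν hi
    (.trans ⟨[], z ++ i :: (g₂ ++ [i]), by simp⟩ hx') (by omega)
  have hl₂ : 2 ≤ adjCount typeEGraph i g₂ := two_le_adjCount hS hν hi
    (.trans ⟨i :: (g₁ ++ i :: z), [], by simp⟩ hx') (by omega)
  exact ⟨g₁, z, g₂, hx', hg₁, hz, hg₂, by omega, by omega, by omega⟩

section Descent

variable {i : ℕ} {x z₁ m m₁ m₂ z₂ x' : List ℕ}

theorem hasInteriorGap_of_gap_two (hS : AvoidsAdjacentBraids typeEGraph S) (hν : ν ∈ S)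
    (hi : 3 ≤ i) (hx : i :: (x ++ (i + 1) :: (z₁ ++ i :: (m ++ i ::
      (z₂ ++ (i + 1) :: (x' ++ [i]))))) <:+: ν)
    (hcount : (x ++ z₁ ++ m ++ z₂ ++ x').count i = 0)
    (hcount' : (x ++ z₁ ++ m ++ z₂ ++ x').count (i + 1) = 0)
    (hcount'' : (z₁ ++ m ++ z₂).count (i + 1 + 1) = 0) : HasInteriorGap ν i := by
  simp only [count_append] at hcount hcount' hcount''
  have hadj : typeEGraph.Adj i (i + 1) := typeEGraph_adj_succ (by omega)
  have hz : adjCount typeEGraph (i + 1) (z₁ ++ i :: (m ++ i :: z₂)) = 2 := by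
    simp only [adjCount_typeEGraph_succ _ hi, count_append, count_cons, beq_iff_eq]
    lia
  have hl := hS.two_le_adjCount_left hν (x := x) (.trans ⟨[], x' ++ [i], by simp⟩ hx) hadj hz
  have hr := hS.two_le_adjCount_right hν (z₁ := z₁ ++ i :: m) (z₂ := z₂) (x := x')
    (.trans ⟨i :: x, [], by simp⟩ hx) hadj (by simpa using hz)
  refine ⟨x ++ (i + 1) :: z₁, m, z₂ ++ (i + 1) :: x', by simpa using hx, ?_⟩
  simp only [count_append, count_cons, beq_iff_eq]
  lia

theorem hasInteriorGap_of_gap_three (hS : AvoidsAdjacentBraids typeEGraph S)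
    (hν : MinimalFor (· ∈ S) List.sum ν)
    (hi : 3 ≤ i) (hx : i :: (x ++ (i + 1) :: (z₁ ++ i :: (m₁ ++ i :: (m₂ ++ i ::
      (z₂ ++ (i + 1) :: (x' ++ [i])))))) <:+: ν)
    (hcount : (x ++ z₁ ++ m₁ ++ m₂ ++ z₂ ++ x').count i = 0)
    (hcount' : (x ++ z₁ ++ m₁ ++ m₂ ++ z₂ ++ x').count (i + 1) = 0)
    (hcount'' : (z₁ ++ m₁ ++ m₂ ++ z₂).count (i + 1 + 1) = 0) : HasInteriorGap ν i := by
  simp only [count_append] at hcount hcount' hcount''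
  have hz : adjCount typeEGraph (i + 1) (z₁ ++ i :: ((m₁ ++ i :: m₂) ++ i :: z₂)) = 3 := by
    simp only [adjCount_typeEGraph_succ _ hi, count_append, count_cons, beq_iff_eq]
    lia
  have h₁ : 2 ≤ adjCount typeEGraph i m₁ := two_le_adjCount hS hν (by omega)
    (.trans ⟨i :: (x ++ (i + 1) :: z₁), m₂ ++ i :: (z₂ ++ (i + 1) :: (x' ++ [i])), by simp⟩ hx)
    (by omega)
  have h₂ : 2 ≤ adjCount typeEGraph i m₂ := two_le_adjCount hS hν (by omega)
    (.trans ⟨i :: (x ++ (i + 1) :: (z₁ ++ i :: m₁)), z₂ ++ (i + 1) :: (x' ++ [i]), by simp⟩ hx)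
    (by omega)
  obtain hl | hr := hS.two_le_adjCount_left_or_right hν.prop (y := m₁ ++ i :: m₂)
    (by simpa using hx) (typeEGraph_adj_succ (by omega)) hz
  · refine ⟨x ++ (i + 1) :: z₁, m₁, m₂,
      .trans ⟨[], z₂ ++ (i + 1) :: (x' ++ [i]), by simp⟩ hx, ?_⟩
    simp only [count_append, count_cons, beq_iff_eq]
    lia
  · refine ⟨m₁, m₂, z₂ ++ (i + 1) :: x', .trans ⟨i :: (x ++ (i + 1) :: z₁), [], by simp⟩ hx, ?_⟩
    simp only [count_append, count_cons, beq_iff_eq]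
    lia

end Descent

theorem HasInteriorGap.pred (hS : AvoidsAdjacentBraids typeEGraph S)
    (hν : MinimalFor (· ∈ S) List.sum ν) {i : ℕ} (hi : 3 ≤ i) (h : HasInteriorGap ν (i + 1)) :
    HasInteriorGap ν i := by
  obtain ⟨g₁, z, g₂, hx, hg₁, hz, hg₂, hz', hl₁, hl₂⟩ := h
  have hlz := two_le_adjCount hS hν (by omega)
    (.trans ⟨(i + 1) :: g₁, g₂ ++ [i + 1], by simp⟩ hx) hz'
  rw [adjCount_typeEGraph_succ _ hi] at hl₁ hl₂ hlz
  obtain h4 | h4 := le_or_gt 4 (z.count i)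
  · exact hasInteriorGap_of_four_le_count hS hν (by omega)
      (.trans ⟨(i + 1) :: (g₁ ++ [i + 1]), (i + 1) :: (g₂ ++ [i + 1]), by simp⟩ hx) hz h4
  obtain ⟨p, x, rfl, hx₀, -⟩ := exists_last_occurrence (i := i) (y := g₁) (by omega)
  obtain ⟨x', p', rfl, hx₀', -⟩ := exists_first_occurrence (i := i) (y := g₂) (by omega)
  obtain ⟨z₁, r, rfl, hz₁, hr⟩ := exists_first_occurrence (i := i) (y := z) (by omega)
  obtain ⟨m, z₂, rfl, hm, hz₂⟩ := exists_first_occurrence (i := i) (y := r) (by omega)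
  obtain hz₂0 | hz₂0 := Nat.eq_zero_or_pos (z₂.count i)
  · simp only [count_append, count_cons, beq_iff_eq] at hg₁ hg₂ hz hz'
    refine hasInteriorGap_of_gap_two (x := x) (z₁ := z₁) (m := m) (z₂ := z₂) (x' := x')
      hS hν.prop hi (.trans ⟨(i + 1) :: p, p' ++ [i + 1], by simp⟩ hx) ?_ ?_ ?_ <;>
    · simp only [count_append]
      omega
  · obtain ⟨m₂, z₂, rfl, hm₂, hz₂'⟩ := exists_first_occurrence hz₂0
    simp only [count_append, count_cons, beq_iff_eq] at hg₁ hg₂ hz hz'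
    refine hasInteriorGap_of_gap_three (x := x) (z₁ := z₁) (m₁ := m) (m₂ := m₂) (z₂ := z₂)
      (x' := x') hS hν hi (.trans ⟨(i + 1) :: p, p' ++ [i + 1], by simp⟩ hx) ?_ ?_ ?_ <;>
    · simp only [count_append]
      omega

theorem count_zero_and_count_two_eq_one (hS : AvoidsAdjacentBraids typeEGraph S)
    (hν : MinimalFor (· ∈ S) List.sum ν) {z : List ℕ} (hx : 3 :: (z ++ [3]) <:+: ν)
    (h3 : z.count 3 = 0) (h4 : z.count 4 = 0) : z.count 0 = 1 ∧ z.count 2 = 1 := by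
  have hz : z <:+: ν := .trans ⟨[3], [3], by simp⟩ hx
  have h0 : z.count 0 ≤ 1 := hS.count_le_one_of_adjCount_eq_zero hν.prop hz
    (by rwa [adjCount_typeEGraph_zero])
  have h2 : z.count 2 ≤ 1 := count_two_le_one hS hν hz h3
  have h := two_le_adjCount hS hν (by omega) hx h4
  rw [adjCount_typeEGraph_three] at h
  omega

theorem count_zero_eq_zero_left (hS : AvoidsAdjacentBraids typeEGraph S) (hν : ν ∈ S)
    {g z : List ℕ} (hx : g ++ 3 :: (z ++ [3]) <:+: ν) (hg : g.count 3 = 0) (hz : z.count 3 = 0)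
    (hz0 : 0 < z.count 0) (hadj : adjCount typeEGraph 3 z = 2) : g.count 0 = 0 := by
  by_contra! h
  obtain ⟨p, x, rfl, -, -⟩ := exists_first_occurrence (Nat.pos_of_ne_zero h)
  obtain ⟨z₁, z₂, rfl, -, -⟩ := exists_first_occurrence hz0
  have hl := hS.two_le_adjCount_left hν (x := x) (.trans ⟨p, [], by simp⟩ hx)
    typeEGraph_adj_zero_three hadj
  simp only [adjCount_typeEGraph_zero, count_append, count_cons, beq_iff_eq] at hl hg hz
  lia

theorem count_zero_eq_zero_right (hS : AvoidsAdjacentBraids typeEGraph S) (hν : ν ∈ S)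
    {g z : List ℕ} (hx : 3 :: (z ++ 3 :: g) <:+: ν) (hg : g.count 3 = 0) (hz : z.count 3 = 0)
    (hz0 : 0 < z.count 0) (hadj : adjCount typeEGraph 3 z = 2) : g.count 0 = 0 := by
  by_contra! h
  obtain ⟨x, p, rfl, -, -⟩ := exists_first_occurrence (Nat.pos_of_ne_zero h)
  obtain ⟨z₁, z₂, rfl, -, -⟩ := exists_first_occurrence hz0
  have hr := hS.two_le_adjCount_right hν (x := x) (.trans ⟨[], p, by simp⟩ hx)
    typeEGraph_adj_zero_three hadj
  simp only [adjCount_typeEGraph_zero, count_append, count_cons, beq_iff_eq] at hr hg hz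
  lia

theorem count_one_eq_zero_of_adjCount_two_eq_two (hS : AvoidsAdjacentBraids typeEGraph S)
    (hν : ν ∈ S) {x y : List ℕ} (hx : 2 :: (x ++ 2 :: y) <:+: ν) (h2x : x.count 2 = 0)
    (h2y : y.count 2 = 0) (h1 : 0 < x.count 1) (hadj : adjCount typeEGraph 2 x = 2) :
    y.count 1 = 0 := by
  by_contra! h
  obtain ⟨y₁, y₂, rfl, -, -⟩ := exists_first_occurrence (Nat.pos_of_ne_zero h)
  obtain ⟨x₁, x₂, rfl, -, -⟩ := exists_first_occurrence h1
  have hr := hS.two_le_adjCount_right hν (x := y₁) (.trans ⟨[], y₂, by simp⟩ hx)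
    (typeEGraph_adj_succ le_rfl) hadj
  simp only [adjCount_typeEGraph_one, count_append, count_cons, beq_iff_eq] at hr h2x h2y
  lia

theorem not_infix_of_gaps_two (hS : AvoidsAdjacentBraids typeEGraph S) (hν : ν ∈ S)
    {x z₁ z₂ x' : List ℕ} (h2 : (x ++ z₁ ++ z₂ ++ x').count 2 = 0)
    (h3 : (x ++ z₁ ++ z₂ ++ x').count 3 = 0)
    (hadj : adjCount typeEGraph 3 (z₁ ++ 2 :: z₂) = 2) :
    ¬ 2 :: (x ++ 3 :: (z₁ ++ 2 :: (z₂ ++ 3 :: (x' ++ [2])))) <:+: ν := by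
  intro hx
  simp only [count_append] at h2 h3
  have h23 : typeEGraph.Adj 2 3 := typeEGraph_adj_succ (by omega)
  have hl : 2 ≤ adjCount typeEGraph 2 (x ++ 3 :: z₁) :=
    hS.two_le_adjCount_left hν (.trans ⟨[], x' ++ [2], by simp⟩ hx) h23 hadj
  have hr : 2 ≤ adjCount typeEGraph 2 (z₂ ++ 3 :: x') :=
    hS.two_le_adjCount_right hν (.trans ⟨2 :: x, [], by simp⟩ hx) h23 hadj
  have hl2 : (x ++ 3 :: z₁).count 2 = 0 := by simp only [count_append, count_cons, beq_iff_eq]; lia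
  have hr2 : (z₂ ++ 3 :: x').count 2 = 0 := by simp only [count_append, count_cons, beq_iff_eq]; lia
  have hl3 : (x ++ 3 :: z₁).count 3 = 1 := by simp only [count_append, count_cons, beq_iff_eq]; lia
  have hr3 : (z₂ ++ 3 :: x').count 3 = 1 := by simp only [count_append, count_cons, beq_iff_eq]; lia
  have hl1 : (x ++ 3 :: z₁).count 1 ≤ 1 := hS.count_le_one_of_adjCount_eq_zero hν
    (.trans ⟨[2], 2 :: (z₂ ++ 3 :: (x' ++ [2])), by simp⟩ hx) (by rwa [adjCount_typeEGraph_one])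
  rw [adjCount_typeEGraph_two] at hl hr
  have hr1 : (z₂ ++ 3 :: x').count 1 = 0 :=
    count_one_eq_zero_of_adjCount_two_eq_two hS hν (.trans ⟨[], [2], by simp⟩ hx) hl2 hr2
      (by omega) (by rw [adjCount_typeEGraph_two]; omega)
  omega

theorem not_hasInteriorGap_three (hS : AvoidsAdjacentBraids typeEGraph S)
    (hν : MinimalFor (· ∈ S) List.sum ν) : ¬ HasInteriorGap ν 3 := by
  rintro ⟨g₁, z, g₂, hx, hg₁, hz, hg₂, hz', hl₁, hl₂⟩
  simp only [Nat.reduceAdd] at hz' hl₁ hl₂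
  obtain ⟨hz0, hz2⟩ := count_zero_and_count_two_eq_one hS hν
    (.trans ⟨3 :: g₁, g₂ ++ [3], by simp⟩ hx) hz hz'
  have hadj : adjCount typeEGraph 3 z = 2 := by rw [adjCount_typeEGraph_three]; omega
  have h₁ : g₁.count 0 = 0 := count_zero_eq_zero_left hS hν.prop
    (.trans ⟨[3], g₂ ++ [3], by simp⟩ hx) hg₁ hz (by omega) hadj
  have h₂ : g₂.count 0 = 0 := count_zero_eq_zero_right hS hν.prop
    (.trans ⟨3 :: g₁, [3], by simp⟩ hx) hg₂ hz (by omega) hadj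
  rw [adjCount_typeEGraph_three] at hl₁ hl₂
  obtain ⟨p, x, rfl, hx₀, -⟩ := exists_last_occurrence (i := 2) (y := g₁) (by omega)
  obtain ⟨x', p', rfl, hx₀', -⟩ := exists_first_occurrence (i := 2) (y := g₂) (by omega)
  obtain ⟨z₁, z₂, rfl, hz₁, hz₂⟩ := exists_first_occurrence (i := 2) (y := z) (by omega)
  simp only [count_append, count_cons, beq_iff_eq] at hg₁ hg₂ hz
  refine not_infix_of_gaps_two hS hν.prop (x := x) (x' := x') ?_ ?_ hadj
    (.trans ⟨3 :: p, p' ++ [3], by simp⟩ hx) <;>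
  · simp only [count_append]
    omega

theorem not_hasInteriorGap (hS : AvoidsAdjacentBraids typeEGraph S)
    (hν : MinimalFor (· ∈ S) List.sum ν) {j : ℕ} (hj : 3 ≤ j) : ¬ HasInteriorGap ν j := by
  induction j, hj using Nat.le_induction with
  | base => exact not_hasInteriorGap_three hS hν
  | succ i hi ih => exact fun h => ih (h.pred hS hν hi)

theorem count_le_three (hS : AvoidsAdjacentBraids typeEGraph S)
    (hν : MinimalFor (· ∈ S) List.sum ν) {x : List ℕ} (hx : x <:+: ν) {t : ℕ}
    (ht : ∀ k ∈ x, k ≤ t) : x.count t ≤ 3 := by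
  have hcount {k : ℕ} (hk : t < k) : x.count k = 0 :=
    count_eq_zero.2 fun hkx => (ht k hkx).not_gt hk
  obtain ht3 | ht3 := le_or_gt 3 t
  · by_contra! h
    exact not_hasInteriorGap hS hν ht3
      (hasInteriorGap_of_four_le_count hS hν (by omega) hx (hcount (by omega)) h)
  · refine le_trans ?_ (by omega : 1 ≤ 3)
    interval_cases t
    · exact hS.count_le_one_of_adjCount_eq_zero hν.prop hx
        (by rw [adjCount_typeEGraph_zero, hcount (by omega)])
    · exact hS.count_le_one_of_adjCount_eq_zero hν.prop hx
        (by rw [adjCount_typeEGraph_one, hcount (by omega)])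
    · exact count_two_le_one hS hν hx (hcount (by omega))

theorem length_lt_four_pow (hS : AvoidsAdjacentBraids typeEGraph S)
    (hν : MinimalFor (· ∈ S) List.sum ν) {m : ℕ} {x : List ℕ} (hx : x <:+: ν)
    (hm : ∀ k ∈ x, k < m) : x.length < 4 ^ m := by
  induction m generalizing x with
  | zero => simp [eq_nil_iff_forall_not_mem.2 fun k hk => Nat.not_lt_zero k (hm k hk)]
  | succ m ih =>
    rw [pow_succ']
    refine length_lt_of_count_le (i := m) (fun y hy hy0 => ih (hy.trans hx) fun k hk => ?_)
      (count_le_three hS hν hx fun k hk => Nat.le_of_lt_succ (hm k hk))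
    have hkm : k ≠ m := by rintro rfl; exact count_eq_zero.1 hy0 hk
    have := hm k (hy.subset hk)
    omega

end TypeE

section ReducedWords

variable {B : Type*} {M : CoxeterMatrix B} {W : Type*} [Group W] {cs : CoxeterSystem M W}

variable (M) in
/-- The Coxeter graph of a simply laced Coxeter matrix: `i` and `j` are joined if `m_{ij} = 3`. -/
def coxeterGraph : SimpleGraph B where
  Adj i j := M i j = 3
  symm := ⟨fun i j h => M.symmetric i j ▸ h⟩
  loopless := ⟨fun i h => by simp at h⟩

instance coxeterGraph.decidableAdj : DecidableRel (coxeterGraph M).Adj :=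
  fun i j => inferInstanceAs (Decidable (M i j = 3))

variable (cs) in
/-- The reduced expressions for `w`, as words in the indices of the Coxeter generators. -/
def reducedWords (w : W) : Set (List B) :=
  {ω | cs.IsReduced ω ∧ cs.wordProd ω = w}

theorem isReduced_of_infix {x ω : List B} (hω : cs.IsReduced ω) (hx : x <:+: ω) :
    cs.IsReduced x := by
  obtain ⟨a, b, rfl⟩ := hx
  simpa only [List.take_left, List.drop_left] using (hω.take (a ++ x).length).drop a.length

theorem mem_reducedWords_of_wordProd_eq {w : W} {ω ω' : List B} (hω : ω ∈ reducedWords cs w)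
    (he : cs.wordProd ω' = cs.wordProd ω) (hl : ω'.length = ω.length) :
    ω' ∈ reducedWords cs w := by
  obtain ⟨hred, rfl⟩ := hω
  exact ⟨by rw [CoxeterSystem.IsReduced, he, hred.eq, hl], he⟩

theorem simple_braid {i j : B} (hij : (coxeterGraph M).Adj i j) :
    cs.simple i * cs.simple j * cs.simple i = cs.simple j * cs.simple i * cs.simple j := by
  have hpow : (cs.simple i * cs.simple j) ^ 3 = 1 := by
    rw [← cs.simple_mul_simple_pow i j, show M i j = 3 from hij]
  have hmul : (cs.simple i * cs.simple j * cs.simple i) *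
      (cs.simple j * cs.simple i * cs.simple j) = 1 := by
    rw [← hpow, pow_succ, pow_two]; simp only [mul_assoc]
  simpa [mul_assoc] using mul_eq_one_iff_eq_inv.1 hmul

theorem wordProd_braid {i j : B} (hij : (coxeterGraph M).Adj i j) (u v : List B) :
    cs.wordProd (u ++ i :: j :: i :: v) = cs.wordProd (u ++ j :: i :: j :: v) := by
  have hbraid := congrArg (· * cs.wordProd v) (simple_braid (cs := cs) hij)
  simp only [mul_assoc] at hbraid
  simp only [CoxeterSystem.wordProd_append, CoxeterSystem.wordProd_cons, hbraid]

theorem eq_two_of_not_adj [hM : M.IsSimplyLaced] {i j : B} (hij : i ≠ j)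
    (h : ¬ (coxeterGraph M).Adj i j) : M i j = 2 :=
  (hM.eq_two_or_eq_three i j hij).resolve_right h

theorem commute_simple [M.IsSimplyLaced] {i j : B} (h : ¬ (coxeterGraph M).Adj i j) :
    Commute (cs.simple i) (cs.simple j) := by
  obtain rfl | hij := eq_or_ne i j
  · exact Commute.refl _
  · have hpow := cs.simple_mul_simple_pow i j
    rw [eq_two_of_not_adj hij h, pow_two, mul_eq_one_iff_eq_inv, mul_inv_rev, cs.inv_simple,
      cs.inv_simple] at hpow
    exact hpow

theorem wordProd_cons_append [M.IsSimplyLaced] {i : B} {y : List B}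
    (h : adjCount (coxeterGraph M) i y = 0) (v : List B) :
    cs.wordProd (i :: (y ++ v)) = cs.wordProd (y ++ i :: v) := by
  have hcomm : Commute (cs.simple i) (cs.wordProd y) := by
    refine Commute.list_prod_right _ _ fun x hx => ?_
    obtain ⟨k, hk, rfl⟩ := List.mem_map.1 hx
    exact commute_simple (adjCount_eq_zero_iff.1 h k hk)
  rw [cs.wordProd_cons, cs.wordProd_append, cs.wordProd_append, cs.wordProd_cons, ← mul_assoc,
    hcomm.eq, mul_assoc]

theorem adjCount_ne_zero_of_isReduced [M.IsSimplyLaced] {i : B} {y : List B}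
    (h : cs.IsReduced (i :: (y ++ [i]))) : adjCount (coxeterGraph M) i y ≠ 0 := by
  intro h0
  have hprod : cs.wordProd (i :: (y ++ [i])) = cs.wordProd y := by
    rw [wordProd_cons_append h0, cs.wordProd_append, cs.wordProd_cons, cs.wordProd_singleton,
      cs.simple_mul_simple_self, mul_one]
  have hlen : (i :: (y ++ [i])).length ≤ y.length := by
    rw [← h.eq, hprod]; exact cs.length_wordProd_le y
  simp at hlen

theorem not_mem_of_isReduced_cons [M.IsSimplyLaced] {i : B} {y : List B}
    (h : cs.IsReduced (i :: y)) (h0 : adjCount (coxeterGraph M) i y = 0) : i ∉ y := by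
  intro hi
  obtain ⟨p, q, rfl⟩ := List.append_of_mem hi
  rw [adjCount_append] at h0
  have hp : cs.IsReduced (i :: (p ++ [i])) := isReduced_of_infix h ⟨[], q, by simp⟩
  exact adjCount_ne_zero_of_isReduced hp (by omega)

theorem not_mem_of_isReduced_append_singleton [M.IsSimplyLaced] {i : B} {y : List B}
    (h : cs.IsReduced (y ++ [i])) (h0 : adjCount (coxeterGraph M) i y = 0) : i ∉ y := by
  intro hi
  obtain ⟨p, q, rfl⟩ := List.append_of_mem hi
  rw [adjCount_append, adjCount_cons] at h0
  have hq : cs.IsReduced (i :: (q ++ [i])) := isReduced_of_infix h ⟨p, [], by simp⟩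
  exact adjCount_ne_zero_of_isReduced hq (by omega)

theorem gather_mem_reducedWords [M.IsSimplyLaced] {w : W} {i j : B} {a y₁ y₂ b : List B}
    (h : a ++ i :: (y₁ ++ j :: (y₂ ++ i :: b)) ∈ reducedWords cs w)
    (h₁ : adjCount (coxeterGraph M) i y₁ = 0) (h₂ : adjCount (coxeterGraph M) i y₂ = 0) :
    (a ++ y₁) ++ i :: j :: i :: (y₂ ++ b) ∈ reducedWords cs w := by
  refine mem_reducedWords_of_wordProd_eq h ?_ (by simp; omega)
  rw [List.append_assoc, cs.wordProd_append a, cs.wordProd_append y₁, cs.wordProd_cons i,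
    cs.wordProd_cons j, wordProd_cons_append h₂, cs.wordProd_append a, wordProd_cons_append h₁,
    cs.wordProd_append y₁, cs.wordProd_cons i, cs.wordProd_cons j]

theorem exists_eq_mul_simple_of_isRightDescent {w : W} {i : B} (h : cs.IsRightDescent w i) :
    ∃ v, w = v * cs.simple i ∧ ¬ cs.IsRightDescent v i ∧ cs.length v < cs.length w := by
  refine ⟨w * cs.simple i, by simp, ?_, h⟩
  exact (cs.isRightDescent_iff_not_isRightDescent_mul).1 h

theorem not_isRightDescent_of_not_adj [M.IsSimplyLaced] {w : W} {i j : B}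
    (hij : ¬ (coxeterGraph M).Adj i j) (hj : ¬ cs.IsRightDescent w j)
    (hji : ¬ cs.IsRightDescent (w * cs.simple j) i) :
    ¬ cs.IsRightDescent w i := by
  rw [cs.not_isRightDescent_iff] at hj hji
  intro hi
  rw [cs.isRightDescent_iff] at hi
  rw [mul_assoc, ← (commute_simple hij).eq, ← mul_assoc] at hji
  have := cs.length_mul_simple (w * cs.simple i) j
  omega

theorem not_isRightDescent_of_adj {w : W} {i j : B} (hij : (coxeterGraph M).Adj i j)
    (hi : ¬ cs.IsRightDescent w i) (hij' : ¬ cs.IsRightDescent (w * cs.simple i) j)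
    (hiji : ¬ cs.IsRightDescent (w * cs.simple i * cs.simple j) i) :
    ¬ cs.IsRightDescent w j := by
  rw [cs.not_isRightDescent_iff] at hi hij' hiji
  intro hj
  rw [cs.isRightDescent_iff] at hj
  have hbraid : w * cs.simple i * cs.simple j * cs.simple i =
      w * cs.simple j * cs.simple i * cs.simple j := by
    simpa only [mul_assoc] using congrArg (w * ·) (simple_braid hij)
  rw [hbraid] at hiji
  have := cs.length_mul_simple (w * cs.simple j) i
  have := cs.length_mul_simple (w * cs.simple j * cs.simple i) j
  omega

end ReducedWords

section ReflectionRep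

open CoxeterMatrix

variable {B : Type*} [Fintype B] [DecidableEq B] {M : CoxeterMatrix B} [M.IsSimplyLaced]
  {W : Type*} [Group W] {cs : CoxeterSystem M W}

theorem reflectionRep_simple_apply (i : B) (v : B → ℝ) :
    cs.reflectionRep (cs.simple i) v = v - (2 * M.coxeterForm v (simpleRoot i)) • simpleRoot i := by
  rw [CoxeterSystem.reflectionRep, cs.lift_apply_simple, simpleReflection_apply]

theorem reflectionRep_simple_self (i : B) :
    cs.reflectionRep (cs.simple i) (simpleRoot i) = -simpleRoot i := by
  rw [reflectionRep_simple_apply, coxeterForm_simpleRoot]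
  simp only [M.diagonal, Nat.cast_one, div_one, Real.cos_pi, neg_neg]
  module

theorem reflectionRep_simple_of_not_adj {i j : B} (hij : i ≠ j)
    (h : ¬ (coxeterGraph M).Adj i j) :
    cs.reflectionRep (cs.simple j) (simpleRoot i) = simpleRoot i := by
  rw [reflectionRep_simple_apply, coxeterForm_simpleRoot, eq_two_of_not_adj hij h]
  simp

theorem reflectionRep_simple_of_adj {i j : B} (h : (coxeterGraph M).Adj i j) :
    cs.reflectionRep (cs.simple j) (simpleRoot i) = simpleRoot i + simpleRoot j := by
  rw [reflectionRep_simple_apply, coxeterForm_simpleRoot, show M i j = 3 from h]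
  simp

theorem reflectionRep_simpleRoot_nonneg {w : W} {i : B} (h : ¬ cs.IsRightDescent w i) :
    0 ≤ cs.reflectionRep w (simpleRoot i) := by
  induction hn : cs.length w using Nat.strong_induction_on generalizing w i with
  | _ n ih =>
    subst hn
    obtain rfl | hw := eq_or_ne w 1
    · simp [simpleRoot]
    obtain ⟨j, hj⟩ := cs.exists_rightDescent_of_ne_one hw
    have hij : i ≠ j := by rintro rfl; exact h hj
    obtain ⟨v, rfl, hvj, hlen⟩ := exists_eq_mul_simple_of_isRightDescent hj
    rw [map_mul, Module.End.mul_apply]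
    by_cases hadj : (coxeterGraph M).Adj i j
    · rw [reflectionRep_simple_of_adj hadj]
      by_cases hvi : cs.IsRightDescent v i
      · obtain ⟨u, rfl, hui, hlen'⟩ := exists_eq_mul_simple_of_isRightDescent hvi
        have huj := not_isRightDescent_of_adj hadj hui hvj h
        have hroot : cs.reflectionRep (cs.simple i) (simpleRoot i + simpleRoot j) =
            simpleRoot j := by
          rw [map_add, reflectionRep_simple_self, reflectionRep_simple_of_adj hadj.symm]
          abel
        rw [map_mul, Module.End.mul_apply, hroot]
        exact ih _ (hlen'.trans hlen) huj rfl
      · rw [map_add]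
        exact add_nonneg (ih _ hlen hvi rfl) (ih _ hlen hvj rfl)
    · rw [reflectionRep_simple_of_not_adj hij hadj]
      exact ih _ hlen (not_isRightDescent_of_not_adj hadj hvj h) rfl

variable (cs) in
/-- The entry of a root sequence contributed by a letter `i` that is followed by the word `v`. -/
noncomputable def letterRoot (i : B) (v : List B) : B → ℝ :=
  cs.reflectionRep (cs.wordProd v)⁻¹ (simpleRoot i)

theorem letterRoot_cons (i k : B) (v : List B) :
    letterRoot cs i (k :: v) =
      cs.reflectionRep (cs.wordProd v)⁻¹ (cs.reflectionRep (cs.simple k) (simpleRoot i)) := by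
  rw [letterRoot, cs.wordProd_cons, mul_inv_rev, map_mul, cs.inv_simple, Module.End.mul_apply]

theorem letterRoot_append_of_adjCount_eq_zero {i : B} {y : List B}
    (h : adjCount (coxeterGraph M) i y = 0) (hi : i ∉ y) (v : List B) :
    letterRoot cs i (y ++ v) = letterRoot cs i v := by
  induction y with
  | nil => rfl
  | cons k y ih =>
    rw [adjCount_eq_zero_iff, List.forall_mem_cons] at h
    rw [List.mem_cons, not_or] at hi
    rw [List.cons_append, letterRoot_cons, reflectionRep_simple_of_not_adj hi.1 h.1]
    exact ih (adjCount_eq_zero_iff.2 h.2) hi.2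

theorem reflectionRep_letterRoot_append (i : B) (u v : List B) :
    cs.reflectionRep (cs.wordProd v) (letterRoot cs i (u ++ v)) = letterRoot cs i u := by
  rw [letterRoot, letterRoot, cs.wordProd_append, mul_inv_rev, ← Module.End.mul_apply, ← map_mul,
    mul_inv_cancel_left]

theorem reflectionRep_wordProd_letterRoot (u : List B) (i : B) (v : List B) :
    cs.reflectionRep (cs.wordProd (u ++ i :: v)) (letterRoot cs i v) =
      -cs.reflectionRep (cs.wordProd u) (simpleRoot i) := by
  rw [letterRoot, ← Module.End.mul_apply, ← map_mul, cs.wordProd_append, cs.wordProd_cons,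
    mul_assoc, mul_inv_cancel_right, map_mul, Module.End.mul_apply, reflectionRep_simple_self,
    map_neg]

theorem letterRoot_nonneg {i : B} {v : List B} (h : cs.IsReduced (i :: v)) :
    0 ≤ letterRoot cs i v := by
  have hv : cs.IsReduced v := isReduced_of_infix h ⟨[i], [], by simp⟩
  refine reflectionRep_simpleRoot_nonneg ?_
  rw [cs.isRightDescent_inv_iff, cs.not_isLeftDescent_iff, ← cs.wordProd_cons, h.eq, hv.eq,
    List.length_cons]

theorem letterRoot_mem_inversionRoots {w : W} {u v : List B} {i : B}
    (h : u ++ i :: v ∈ reducedWords cs w) : letterRoot cs i v ∈ cs.inversionRoots w := by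
  obtain ⟨hred, rfl⟩ := h
  have hv : 0 ≤ letterRoot cs i v :=
    letterRoot_nonneg (isReduced_of_infix hred ⟨u, [], by simp⟩)
  have hu : 0 ≤ cs.reflectionRep (cs.wordProd u) (simpleRoot i) := by
    have hui : cs.IsReduced (u ++ [i]) := isReduced_of_infix hred ⟨[], v, by simp⟩
    have hu' : cs.IsReduced u := isReduced_of_infix hui ⟨[], [i], by simp⟩
    refine reflectionRep_simpleRoot_nonneg ?_
    rw [cs.not_isRightDescent_iff, ← cs.wordProd_singleton, ← cs.wordProd_append, hui.eq, hu'.eq,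
      List.length_append, List.length_singleton]
  refine ⟨⟨⟨_, i, rfl⟩, hv⟩, ⟨cs.wordProd (u ++ i :: v) * (cs.wordProd v)⁻¹, i, ?_⟩, fun k => ?_⟩
  · rw [map_mul, Module.End.mul_apply, letterRoot]
  · rw [reflectionRep_wordProd_letterRoot, Pi.neg_apply]
    exact neg_nonpos.2 (hu k)

theorem letterRoot_ne {c b : List B} {i k : B} (h : cs.IsReduced (i :: c)) :
    letterRoot cs i (c ++ k :: b) ≠ letterRoot cs k b := by
  intro he
  have hneg : letterRoot cs i c = -simpleRoot k := by
    rw [← reflectionRep_letterRoot_append i c (k :: b), he]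
    simpa using reflectionRep_wordProd_letterRoot (cs := cs) [] k b
  have hk := letterRoot_nonneg h k
  simp only [hneg, Pi.zero_apply, Pi.neg_apply, simpleRoot, Pi.single_eq_same] at hk
  linarith

theorem rootSeq_isPrefix_append (u v : List B) : cs.rootSeq v <+: cs.rootSeq (u ++ v) := by
  induction u with
  | nil => exact List.prefix_rfl
  | cons i u ih => exact ih.trans (List.prefix_append _ _)

end ReflectionRep

section Braids

open CoxeterMatrix

variable {B : Type*} [Fintype B] [DecidableEq B] {M : CoxeterMatrix B} [M.IsSimplyLaced]
  {W : Type*} [Group W] {cs : CoxeterSystem M W} {w : W} {i j : B}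

variable (cs) in
/-- The roots contributed to a root sequence by a braid `i j i` that is followed by the word `v`. -/
def braidRoots (i j : B) (v : List B) : Set (B → ℝ) :=
  {letterRoot cs i v, letterRoot cs j (i :: v), letterRoot cs i (j :: i :: v)}

theorem letterRoot_add_letterRoot (hij : (coxeterGraph M).Adj i j) (v : List B) :
    letterRoot cs i v + letterRoot cs i (j :: i :: v) = letterRoot cs j (i :: v) := by
  rw [letterRoot_cons, letterRoot_cons, reflectionRep_simple_of_adj hij,
    reflectionRep_simple_of_adj hij.symm, cs.wordProd_cons, mul_inv_rev, cs.inv_simple, map_mul,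
    Module.End.mul_apply, map_add (cs.reflectionRep (cs.simple i)), reflectionRep_simple_self,
    reflectionRep_simple_of_adj hij.symm, letterRoot, ← map_add]
  congr 1
  abel

theorem isContractibleTriple_braidRoots {u v : List B}
    (h : u ++ i :: j :: i :: v ∈ reducedWords cs w) (hij : (coxeterGraph M).Adj i j) :
    cs.IsContractibleTriple w (braidRoots cs i j v) := by
  refine ⟨⟨?_, letterRoot cs i v, letterRoot cs i (j :: i :: v), ?_⟩, _, ⟨_, h.1, h.2, rfl⟩,
    _, _, _, ?_, rfl⟩
  · rintro α (rfl | rfl | rfl)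
    · exact letterRoot_mem_inversionRoots (u := u ++ [i, j]) (by simpa using h)
    · exact letterRoot_mem_inversionRoots (u := u ++ [i]) (by simpa using h)
    · exact letterRoot_mem_inversionRoots h
  · rw [letterRoot_add_letterRoot hij, braidRoots, Set.pair_comm]
  · refine List.IsInfix.trans ?_ (rootSeq_isPrefix_append u _).isInfix
    exact ⟨cs.rootSeq v, [], by simp [CoxeterSystem.rootSeq, letterRoot]⟩

theorem isHighestRoot_braidRoots {v : List B} (h : cs.IsReduced (i :: j :: i :: v))
    (hij : (coxeterGraph M).Adj i j) :
    CoxeterSystem.IsHighestRoot (braidRoots cs i j v) (letterRoot cs j (i :: v)) := by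
  have hsum : CoxeterSystem.rootHeight (letterRoot cs j (i :: v)) =
      CoxeterSystem.rootHeight (letterRoot cs i v) +
        CoxeterSystem.rootHeight (letterRoot cs i (j :: i :: v)) := by
    simp only [← letterRoot_add_letterRoot hij, CoxeterSystem.rootHeight, Pi.add_apply,
      Finset.sum_add_distrib]
  have hfirst : 0 ≤ CoxeterSystem.rootHeight (letterRoot cs i v) :=
    Finset.sum_nonneg fun k _ => letterRoot_nonneg (isReduced_of_infix h ⟨[i, j], [], by simp⟩) k
  have hlast : 0 ≤ CoxeterSystem.rootHeight (letterRoot cs i (j :: i :: v)) :=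
    Finset.sum_nonneg fun k _ => letterRoot_nonneg h k
  refine ⟨by simp [braidRoots], ?_⟩
  rintro α (rfl | rfl | rfl) <;> linarith

theorem exists_isContractibleTriple_of_braid {a y₁ y₂ b : List B}
    (h : a ++ i :: (y₁ ++ j :: (y₂ ++ i :: b)) ∈ reducedWords cs w)
    (hij : (coxeterGraph M).Adj i j) (h₁ : adjCount (coxeterGraph M) i y₁ = 0)
    (h₂ : adjCount (coxeterGraph M) i y₂ = 0) :
    ∃ T, cs.IsContractibleTriple w T ∧
      CoxeterSystem.IsHighestRoot T (letterRoot cs j (y₂ ++ i :: b)) ∧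
      letterRoot cs i (y₁ ++ j :: (y₂ ++ i :: b)) ∈ T ∧ letterRoot cs i b ∈ T := by
  have hgather := gather_mem_reducedWords h h₁ h₂
  have hi₁ : i ∉ y₁ := not_mem_of_isReduced_cons (cs := cs)
    (isReduced_of_infix h.1 ⟨a, j :: (y₂ ++ i :: b), by simp⟩) h₁
  have hi₂ : i ∉ y₂ := not_mem_of_isReduced_append_singleton (cs := cs)
    (isReduced_of_infix h.1 ⟨a ++ i :: (y₁ ++ [j]), b, by simp⟩) h₂
  have hfirst : letterRoot cs i (y₂ ++ b) = letterRoot cs i b :=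
    letterRoot_append_of_adjCount_eq_zero h₂ hi₂ b
  have hmiddle : letterRoot cs j (i :: (y₂ ++ b)) = letterRoot cs j (y₂ ++ i :: b) := by
    rw [letterRoot, wordProd_cons_append h₂, letterRoot]
  have hlast : letterRoot cs i (j :: i :: (y₂ ++ b)) =
      letterRoot cs i (y₁ ++ j :: (y₂ ++ i :: b)) := by
    rw [letterRoot_append_of_adjCount_eq_zero h₁ hi₁, letterRoot_cons, wordProd_cons_append h₂,
      letterRoot_cons]
  have hred : cs.IsReduced (i :: j :: i :: (y₂ ++ b)) :=
    isReduced_of_infix hgather.1 ⟨a ++ y₁, [], by simp⟩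
  refine ⟨braidRoots cs i j (y₂ ++ b), isContractibleTriple_braidRoots hgather hij,
    hmiddle ▸ isHighestRoot_braidRoots hred hij, ?_, ?_⟩
  · simp [braidRoots, hlast]
  · simp [braidRoots, hfirst]

/-- Two braids `jkj` and `jlj` sharing a letter `j` would give contractible triples that share the
root of this letter but have the distinct roots of the letters `k` and `l` as highest roots. -/
theorem avoidsAdjacentBraids_reducedWords (hw : cs.IsMaximallyClustered w) :
    AvoidsAdjacentBraids (coxeterGraph M) (reducedWords cs w) where
  adjCount_ne_zero {i a y b} h :=
    adjCount_ne_zero_of_isReduced (isReduced_of_infix h.1 ⟨a, b, by simp⟩)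
  braid_mem {i j a y₁ y₂ b} h hij h₁ h₂ := by
    have hgather := gather_mem_reducedWords h h₁ h₂
    rw [← List.append_assoc]
    exact mem_reducedWords_of_wordProd_eq hgather (wordProd_braid hij _ _).symm (by simp)
  adjCount_ne_one {j a y y' b} h hy hy' := by
    obtain ⟨y₁, k, y₂, rfl, hk, hy₁, hy₂⟩ := exists_of_adjCount_eq_one hy
    obtain ⟨z₁, l, z₂, rfl, hl, hz₁, hz₂⟩ := exists_of_adjCount_eq_one hy'
    obtain ⟨T, hT, hhigh, -, hmem⟩ := exists_isContractibleTriple_of_braid (a := a) (y₁ := y₁)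
      (y₂ := y₂) (b := z₁ ++ l :: z₂ ++ j :: b) (by simpa using h) hk hy₁ hy₂
    obtain ⟨T', hT', hhigh', hmem', -⟩ := exists_isContractibleTriple_of_braid
      (a := a ++ j :: (y₁ ++ k :: y₂)) (y₁ := z₁) (y₂ := z₂) (b := b) (by simpa using h) hl hz₁ hz₂
    have hroots := hw T T' hT hT' ⟨_, by simpa using hmem, hmem'⟩ _ _ hhigh hhigh'
    refine letterRoot_ne (cs := cs) (i := k) (c := y₂ ++ j :: z₁) (k := l) (b := z₂ ++ j :: b)
      (isReduced_of_infix h.1 ⟨a ++ j :: y₁, l :: z₂ ++ j :: b, by simp⟩) ?_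
    simpa using hroots

end Braids

/-- The Coxeter graph of `E_n`, embedded into the infinite graph `typeEGraph` by its labels. -/
def typeEEmbedding (n : ℕ) : coxeterGraph (CoxeterMatrix.typeE n) ↪g typeEGraph where
  toFun := Fin.val
  inj' := Fin.val_injective
  map_rel_iff' {i j} := by
    rw [Function.Embedding.coeFn_mk, typeEGraph_adj]
    change _ ↔ (if i = j then 1 else
      if CoxeterMatrix.typeEEdge i j ∨ CoxeterMatrix.typeEEdge j i then 3 else 2) = 3
    split_ifs with hij hedge
    · subst hij
      simp only [CoxeterMatrix.typeEEdge]
      omega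
    · simp [hedge]
    · simp [hedge]

end MaximallyClustered

open MaximallyClustered in
theorem theorem7p2_general {B : Type*} [Fintype B] [DecidableEq B] {M : CoxeterMatrix B}
    [M.IsSimplyLaced] {W : Type*} [Group W] (cs : CoxeterSystem M W)
    (f : coxeterGraph M ↪g typeEGraph) : {w : W | cs.IsMaximallyClustered w}.Finite := by
  obtain ⟨m, hm⟩ : ∃ m, ∀ i, f i < m :=
    ⟨Finset.univ.sup f + 1, fun i => Nat.lt_succ_of_le (Finset.le_sup (Finset.mem_univ i))⟩
  refine ((List.finite_length_lt B (4 ^ m)).image cs.wordProd).subset fun w hw => ?_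
  obtain ⟨ω₀, hred, hω₀⟩ := cs.exists_isReduced w
  obtain ⟨ν, hν⟩ : ∃ ν, MinimalFor (· ∈ List.map f '' reducedWords cs w) List.sum ν :=
    exists_minimalFor_of_wellFoundedLT _ _ ⟨_, ω₀, ⟨hred, hω₀.symm⟩, rfl⟩
  obtain ⟨ω, hω, rfl⟩ := hν.prop
  have hlen : (ω.map f).length < 4 ^ m :=
    length_lt_four_pow ((avoidsAdjacentBraids_reducedWords hw).image_map f) hν List.infix_rfl
      (by simpa using fun i _ => hm i)
  exact ⟨ω, by simpa using hlen, hω.2⟩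

theorem theorem7p2 (n : ℕ) (hn : 6 ≤ n) {W : Type*} [Group W]
    (cs : CoxeterSystem (CoxeterMatrix.typeE n) W) :
    {w : W | cs.IsMaximallyClustered w}.Finite :=
  theorem7p2_general cs (MaximallyClustered.typeEEmbedding n)
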